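/- There is a universal constant $C>0$ such that the following holds. Let $d\ge 2$ be an integer and let $\theta,\eta,\beta>0$ be real constants with $d\theta<\tfrac12$ and $\eta\beta^2\ge C d$. For every $p\ge 1$ let $p$ vertices be drawn independently and uniformly from a square of side length $s$, where $p=\eta s^2$. Given the vertices, let $\mathfrak H$ be the family of all simple graphs on them in which every vertex has degree at most $d$ and every edge has Euclidean length at most $\beta$, and let $\mathcal G$ be drawn uniformly from $\mathfrak H$. Given $\mathcal G$ with adjacency matrix $\mathbf E$, let $\mathbf x_1,\dots,\mathbf x_n\in\mathbb R^p$ be i.i.d. samples of the centered Gaussian distribution with precision (inverse covariance) matrix $\mathbf J=\mathbf I+\theta\mathbf E$. For each $p$ let $n=n(p)$ be a sample size and let $\widehat{\mathcal G}$ be any estimator of $\mathcal G$ that is a measurable function of the vertex positions and of the $n(p)$ samples; put $\mathbb P_e(p)=\mathbb P[\widehat{\mathcal G}\ne\mathcal G]$, the probability being taken over the vertices, the graph and the samples. If $\mathbb P_e(p)\to 0$ as $p\to\infty$, then for all sufficiently large $p$ $$ n(p)\;\ge\;\frac{\log\left(\frac{\eta\beta^2}{d}\right)}{2\left(\frac{\theta}{1-d\theta}\right)^2},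 $$ where $\log$ is the natural logarithm. -/

import Mathlib

open MeasureTheory ProbabilityTheory Filter Topology
open scoped ENNReal Matrix

noncomputable section

namespace GeomGraph

/-- The Euclidean plane. -/
abbrev Plane : Type := EuclideanSpace ℝ (Fin 2)

/-- The square `[0, s] × [0, s]`. -/
def square (s : ℝ) : Set Plane := {y | ∀ i, y i ∈ Set.Icc 0 s}

/-- The law of `p` independent vertices, each uniformly distributed over the square whose side
length `s` satisfies `p = η * s ^ 2`. -/
def vertexLaw (η : ℝ) (p : ℕ) : Measure (Fin p → Plane) :=
  Measure.pi fun _ => ProbabilityTheory.cond volume (square (Real.sqrt (p / η)))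

/-- A graph on vertices placed at `y` is admissible if all its degrees are at most `d` and
all its edges have Euclidean length at most `β`. -/
structure IsAdmissible (d : ℕ) (β : ℝ) {p : ℕ} (y : Fin p → Plane)
    (G : SimpleGraph (Fin p)) : Prop where
  degree_le : ∀ i, (G.neighborSet i).ncard ≤ d
  length_le : ∀ i j, G.Adj i j → ‖y i - y j‖ ≤ β

open Classical in
/-- The finite family of all admissible graphs on the vertices `y`. -/
def admissible (d : ℕ) (β : ℝ) {p : ℕ} (y : Fin p → Plane) : Finset (SimpleGraph (Fin p)) :=
  Finset.univ.filter (IsAdmissible d β y)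

open Classical in
/-- The precision matrix `J = I + θ E`, with `E` the adjacency matrix of `G`. -/
def precision (θ : ℝ) {p : ℕ} (G : SimpleGraph (Fin p)) : Matrix (Fin p) (Fin p) ℝ :=
  1 + θ • G.adjMatrix ℝ

/-- The density of the centered Gaussian distribution with precision matrix `J`. -/
def gaussianDensity {p : ℕ} (J : Matrix (Fin p) (Fin p) ℝ) (x : Fin p → ℝ) : ℝ :=
  (Real.sqrt ((2 * Real.pi) ^ p * (J⁻¹).det))⁻¹ * Real.exp (-(1 / 2) * (x ⬝ᵥ J *ᵥ x))

/-- The law of one sample from the Gaussian graphical model over `G`. -/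
def sampleLaw (θ : ℝ) {p : ℕ} (G : SimpleGraph (Fin p)) : Measure (Fin p → ℝ) :=
  volume.withDensity fun x => ENNReal.ofReal (gaussianDensity (precision θ G) x)

/-- The zero-one error probability of a decoder `ψ` that sees the vertex positions and `n`
samples: the vertices follow `vertexLaw`, given them the graph is uniform over the admissible
family, and given both the samples are i.i.d. from the graphical model over that graph. -/
def errorProb (d : ℕ) (θ η β : ℝ) (p n : ℕ)
    (ψ : (Fin p → Plane) × (Fin n → Fin p → ℝ) → SimpleGraph (Fin p)) : ℝ≥0∞ :=
  ∫⁻ y, ((admissible d β y).card : ℝ≥0∞)⁻¹ *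
      ∑ G ∈ admissible d β y,
        (Measure.pi fun _ : Fin n => sampleLaw θ G) {x | ψ (y, x) ≠ G}
    ∂(vertexLaw η p)

end GeomGraph

end

/-! The argument is a strong converse: if `n` is below the threshold and the square has side at
least `β / 2`, every decoder errs with probability at least 1/2, so the error cannot tend to 0. Two
estimates are compared, with `A = η β² / d`, `δ = θ / (1 - d θ)` and `N` the number of admissible
graphs.

Counting (`pow_le_card_admissible`): wherever the vertices lie in the square, `N ≥ (A / 100) ^ (p
⌊d/2⌋)`. Cut the square into cells of diameter at most `β` and superpose `⌊d/2⌋` permutations that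
preserve the cells. No concentration of the vertices is needed, because uneven occupancy only
increases the product of factorials that counts such permutations.

Information (`lintegral_density_mul_sqrt_le`): against the standard Gaussian density `q`, each
sample density `f` satisfies `∫ f √(f/q) ≤ m = exp(p d δ² / 4)`, a Rényi divergence bound of order
3/2. By `sum_pi_withDensity_le`, the success probabilities then sum to at most `K + N m^n / √K` for
every `K > 0`. With `K = N / 4` this is at most `N / 2` as soon as `64 m^(2n) ≤ N`. Below the
threshold `m^(2n) ≤ A^(p d / 4)`, whereas `⌊d/2⌋ ≥ d/3`, so for `A` large the family wins. -/

noncomputable section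

namespace GeomGraph

/-! ### Counting admissible graphs -/

/-- The graph joining each vertex to its images under finitely many permutations. -/
def permGraph {p r : ℕ} (σ : Fin r → Equiv.Perm (Fin p)) : SimpleGraph (Fin p) :=
  SimpleGraph.fromRel fun i j => ∃ k, σ k i = j

theorem ncard_neighborSet_permGraph_le {p r : ℕ} (σ : Fin r → Equiv.Perm (Fin p)) (i : Fin p) :
    ((permGraph σ).neighborSet i).ncard ≤ 2 * r := by
  have hsub : (permGraph σ).neighborSet i ⊆
      ((Finset.univ.image fun k => σ k i) ∪ (Finset.univ.image fun k => (σ k).symm i) :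
        Finset (Fin p)) := by
    intro j hj
    rw [SimpleGraph.mem_neighborSet, permGraph, SimpleGraph.fromRel_adj] at hj
    rcases hj.2 with ⟨k, hk⟩ | ⟨k, hk⟩
    · simp only [Finset.coe_union, Finset.coe_image]
      exact Or.inl ⟨k, by simp, hk⟩
    · simp only [Finset.coe_union, Finset.coe_image]
      exact Or.inr ⟨k, by simp, by rw [← hk]; simp⟩
  refine (Set.ncard_le_ncard hsub (Finset.finite_toSet _)).trans ?_
  rw [Set.ncard_coe_finset]
  refine (Finset.card_union_le _ _).trans ?_
  rw [two_mul]
  exact add_le_add (Finset.card_image_le.trans (by simp)) (Finset.card_image_le.trans (by simp))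

-- The product of factorials counts the permutations that preserve every fibre of `c`. An `r`-tuple
-- of them yields an admissible graph, and a graph comes from at most `(d + 1) ^ (p * r)` tuples:
-- each permutation sends `i` to itself or to one of its at most `d` neighbours.
open Classical in
theorem prod_factorial_pow_le_card_admissible {p d r : ℕ} {β : ℝ} {κ : Type*} [Fintype κ]
    (hr : 2 * r ≤ d) (y : Fin p → Plane) (c : Fin p → κ)
    (hc : ∀ i j, c i = c j → ‖y i - y j‖ ≤ β) :
    (∏ k, (Nat.card {i // c i = k}).factorial) ^ r ≤
      (d + 1) ^ (p * r) * (admissible d β y).card := by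
  have hstab := DomMulAct.stabilizer_card c
  simp_rw [← Nat.card_eq_fintype_card (α := {i // c i = _})] at hstab
  rw [← hstab]
  set S := {g : Equiv.Perm (Fin p) // c ∘ g = c}
  have hcard : (Finset.univ : Finset (Fin r → S)).card = Fintype.card S ^ r := by
    rw [Finset.card_univ, Fintype.card_fun, Fintype.card_fin]
  rw [← hcard]
  have hcell : ∀ (g : S) i, c (g.1 i) = c i := fun g i => congrFun g.2 i
  refine Finset.card_le_mul_card_image_of_maps_to
    (f := fun σ : Fin r → S => permGraph fun k => (σ k).1) (fun σ _ => ?_) _ fun G hG => ?_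
  · rw [admissible, Finset.mem_filter]
    refine ⟨Finset.mem_univ _, fun i => (ncard_neighborSet_permGraph_le _ i).trans hr,
      fun i j hij => hc i j ?_⟩
    rw [permGraph, SimpleGraph.fromRel_adj] at hij
    rcases hij.2 with ⟨k, hk⟩ | ⟨k, hk⟩
    · rw [← hk, hcell]
    · rw [← hk, hcell]
  · rw [admissible, Finset.mem_filter] at hG
    have hle : ∀ i, (insert i (G.neighborFinset i)).card ≤ d + 1 := fun i => by
      refine (Finset.card_insert_le _ _).trans (Nat.succ_le_succ ?_)
      have := hG.2.degree_le i
      rwa [Set.ncard_eq_toFinset_card'] at this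
    refine (Finset.card_le_card_of_injOn (fun σ k i => (σ k).1 i)
      (t := Fintype.piFinset fun _ : Fin r => Fintype.piFinset fun i : Fin p =>
        insert i (G.neighborFinset i)) ?_ ?_).trans ?_
    · intro σ hσ
      simp only [Finset.coe_filter, Finset.mem_univ, true_and, Set.mem_ofPred_eq] at hσ
      simp only [Finset.mem_coe, Fintype.mem_piFinset, Finset.mem_insert,
        SimpleGraph.mem_neighborFinset]
      intro k i
      by_cases h : (σ k).1 i = i
      · exact Or.inl h
      · right
        rw [← hσ, permGraph, SimpleGraph.fromRel_adj]
        exact ⟨fun h' => h h'.symm, Or.inl ⟨k, rfl⟩⟩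
    · intro σ _ τ _ h
      funext k
      exact Subtype.ext (Equiv.ext fun i => congrFun (congrFun h k) i)
    · rw [Fintype.card_piFinset, Finset.prod_const, Finset.card_univ, Fintype.card_fin,
        Fintype.card_piFinset, pow_mul]
      refine Nat.pow_le_pow_left ?_ r
      calc _ ≤ ∏ _i : Fin p, (d + 1) := Finset.prod_le_prod' fun i _ => hle i
        _ = _ := by simp

-- Multiply `a ^ k / k! ≤ exp a` over the cells. The bound holds for every occupancy profile; it is
-- useful when `a` is at most the mean occupancy.
open Classical in
theorem pow_le_exp_mul_prod_factorial {p : ℕ} {κ : Type*} [Fintype κ] (c : Fin p → κ) {a : ℝ}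
    (ha : 0 ≤ a) :
    a ^ p ≤ Real.exp (Fintype.card κ * a) *
      (∏ k, (Nat.card {i // c i = k}).factorial : ℕ) := by
  have hsum : ∑ k, Nat.card {i // c i = k} = p := by
    simp_rw [Nat.card_eq_fintype_card]
    rw [← Fintype.card_sigma, Fintype.card_congr (Equiv.sigmaFiberEquiv c), Fintype.card_fin]
  calc a ^ p = ∏ k, a ^ Nat.card {i // c i = k} := by
        rw [Finset.prod_pow_eq_pow_sum, hsum]
    _ ≤ ∏ k, (Real.exp a * (Nat.card {i // c i = k}).factorial) := by
        refine Finset.prod_le_prod (fun k _ => by positivity) fun k _ => ?_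
        rw [← div_le_iff₀ (by positivity)]
        exact Real.pow_div_factorial_le_exp a ha _
    _ = _ := by
        rw [Finset.prod_mul_distrib, Finset.prod_const, Finset.card_univ, ← Real.exp_nat_mul]
        push_cast
        rfl

/-- A cell of side `β / 2` has diagonal `β / √2 ≤ β`. -/
theorem norm_sub_le_of_floor_eq {y z : Plane} {β : ℝ} (hβ : 0 < β)
    (hy : ∀ k, 0 ≤ y k) (hz : ∀ k, 0 ≤ z k)
    (h : ∀ k, ⌊y k / (β / 2)⌋₊ = ⌊z k / (β / 2)⌋₊) : ‖y - z‖ ≤ β := by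
  have hk : ∀ k, (y k - z k) ^ 2 ≤ (β / 2) ^ 2 := by
    intro k
    have h1 := Nat.floor_le (div_nonneg (hy k) (by positivity : 0 ≤ β / 2))
    have h2 := Nat.lt_floor_add_one (y k / (β / 2))
    have h3 := Nat.floor_le (div_nonneg (hz k) (by positivity : 0 ≤ β / 2))
    have h4 := Nat.lt_floor_add_one (z k / (β / 2))
    rw [h k] at h1 h2
    rw [le_div_iff₀ (by positivity)] at h1 h3
    rw [div_lt_iff₀ (by positivity)] at h2 h4
    rw [sq_le_sq, abs_of_pos (by positivity : 0 < β / 2), abs_le]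
    constructor <;> nlinarith
  rw [EuclideanSpace.norm_eq, Fin.sum_univ_two, Real.sqrt_le_left hβ.le]
  have h0 := hk 0
  have h1 := hk 1
  simp only [PiLp.sub_apply, Real.norm_eq_abs, sq_abs]
  nlinarith [sq_nonneg β]

open Classical in
/-- Whatever the positions of the vertices in the square, the admissible family is large. -/
theorem pow_le_card_admissible {d p : ℕ} {η β : ℝ} (hd : 1 < d) (hη : 0 < η) (hβ : 0 < β)
    (hp : β / 2 ≤ Real.sqrt (p / η)) (y : Fin p → Plane)
    (hy : ∀ i, y i ∈ square (Real.sqrt (p / η))) :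
    (η * β ^ 2 / d / 100) ^ (p * (d / 2)) ≤ ((admissible d β y).card : ℝ) := by
  set s := Real.sqrt (p / η)
  have hs2 : s ^ 2 = p / η := Real.sq_sqrt (by positivity)
  -- The extra cell receives points on the far side of the closed square.
  set N := ⌊s / (β / 2)⌋₊ + 1
  let c : Fin p → (Fin 2 → Fin N) := fun i k =>
    ⟨⌊y i k / (β / 2)⌋₊, Nat.lt_succ_of_le (Nat.floor_le_floor
      (div_le_div_of_nonneg_right (hy i k).2 (by positivity)))⟩
  have hc : ∀ i j, c i = c j → ‖y i - y j‖ ≤ β := fun i j h =>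
    norm_sub_le_of_floor_eq hβ (fun k => (hy i k).1) (fun k => (hy j k).1) fun k =>
      congrArg Fin.val (congrFun h k)
  have hdr : (2 : ℝ) ≤ d := by exact_mod_cast hd
  -- With at most `(4 s / β)²` cells, the mean occupancy is at least this value, so the factor `exp
  -- (#cells * a)` is at most `exp p`.
  set a := η * β ^ 2 / 16
  have ha : 0 < a := by positivity
  have h1 := prod_factorial_pow_le_card_admissible (d := d) (r := d / 2)
    (Nat.mul_div_le d 2) y c hc
  have h2 := pow_le_exp_mul_prod_factorial c ha.le
  set M := ∏ k, (Nat.card {i // c i = k}).factorial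
  have hK : (Fintype.card (Fin 2 → Fin N) : ℝ) * a ≤ p := by
    have hN : (N : ℝ) ≤ 4 * s / β := by
      have e1 : (⌊s / (β / 2)⌋₊ : ℝ) ≤ s / (β / 2) := Nat.floor_le (by positivity)
      have e2 : 1 ≤ s / (β / 2) := (one_le_div (by positivity)).2 hp
      have e3 : 4 * s / β = s / (β / 2) + s / (β / 2) := by field_simp; ring
      push_cast [N]
      linarith
    have : (N : ℝ) ^ 2 ≤ (4 * s / β) ^ 2 := by gcongr
    rw [Fintype.card_fun, Fintype.card_fin, Fintype.card_fin]
    push_cast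
    calc (N : ℝ) ^ 2 * a ≤ (4 * s / β) ^ 2 * a := by gcongr
      _ = s ^ 2 * η := by simp only [a]; field_simp; ring
      _ = p := by rw [hs2]; field_simp
  have h3 : (a / Real.exp 1) ^ p ≤ M := by
    rw [div_pow, div_le_iff₀ (by positivity), ← Real.exp_nat_mul, mul_one, mul_comm]
    refine h2.trans ?_
    gcongr
  have h4 : (a / Real.exp 1) ^ (p * (d / 2)) ≤
      ((d : ℝ) + 1) ^ (p * (d / 2)) * (admissible d β y).card := by
    rw [pow_mul]
    refine (pow_le_pow_left₀ (by positivity) h3 _).trans ?_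
    exact_mod_cast h1
  -- The constant 100 absorbs `16 e (d + 1) / d ≤ 24 e`, as `d ≥ 2`.
  have h5 : η * β ^ 2 / d / 100 ≤ a / Real.exp 1 / (d + 1) := by
    have he : Real.exp 1 < 2.7182818286 := Real.exp_one_lt_d9
    rw [div_div, div_div, div_div, div_le_div_iff₀ (by positivity) (by positivity)]
    have : 16 * (Real.exp 1 * (d + 1)) ≤ d * 100 := by
      nlinarith [Real.exp_pos 1]
    exact mul_le_mul_of_nonneg_left this (by positivity)
  refine (pow_le_pow_left₀ (by positivity) h5 _).trans ?_
  rw [div_pow, div_le_iff₀ (by positivity), mul_comm _ (_ ^ _)]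
  exact h4

/-! ### Gaussian integrals -/

theorem lintegral_fin_prod {n : ℕ} {α : Type*} [MeasurableSpace α] (μ : Measure α) [SigmaFinite μ]
    (f : Fin n → α → ℝ≥0∞) (hf : ∀ i, Measurable (f i)) :
    ∫⁻ x, ∏ i, f i (x i) ∂(Measure.pi fun _ : Fin n => μ) = ∏ i, ∫⁻ x, f i x ∂μ := by
  induction n with
  | zero => simp [Measure.pi_empty_univ]
  | succ n ih =>
    have h := (measurePreserving_piFinSuccAbove (fun _ : Fin (n + 1) => μ) 0).symm
    rw [← h.lintegral_comp_emb (MeasurableEquiv.measurableEmbedding _)]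
    simp_rw [MeasurableEquiv.piFinSuccAbove_symm_apply, Fin.insertNthEquiv,
      Fin.prod_univ_succ, Equiv.coe_fn_mk, Fin.insertNth_zero]
    simp only [Fin.cons_zero, Fin.cons_succ]
    have h2 := lintegral_prod_mul (μ := μ) (ν := Measure.pi fun _ : Fin n => μ)
      (f := f 0) (g := fun x => ∏ i : Fin n, f i.succ (x i)) (hf 0).aemeasurable
      (Finset.measurable_prod _ fun i _ => (hf i.succ).comp (measurable_pi_apply i)).aemeasurable
    rw [ih (fun i => f i.succ) (fun i => hf i.succ)] at h2
    exact h2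

theorem lintegral_exp_neg_mul_sq {w : ℝ} (hw : 0 < w) :
    ∫⁻ x : ℝ, ENNReal.ofReal (Real.exp (-(w / 2) * x ^ 2)) =
      ENNReal.ofReal (Real.sqrt (2 * Real.pi / w)) := by
  rw [← ofReal_integral_eq_lintegral_ofReal, integral_gaussian]
  · congr 2; field_simp
  · exact integrable_exp_neg_mul_sq (by positivity)
  · exact Eventually.of_forall fun x => (Real.exp_pos _).le

/-- The orthogonal substitution `z = Uᵀ x` preserves volume and splits the integral into
one-dimensional Gaussian integrals. -/
theorem lintegral_exp_neg_quadForm {p : ℕ} (U : Matrix (Fin p) (Fin p) ℝ) (hU : U * Uᵀ = 1)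
    (w : Fin p → ℝ) (hw : ∀ i, 0 < w i) :
    ∫⁻ x : Fin p → ℝ,
        ENNReal.ofReal (Real.exp (-(1 / 2) * (x ⬝ᵥ (U * Matrix.diagonal w * Uᵀ) *ᵥ x))) =
      ENNReal.ofReal (∏ i, Real.sqrt (2 * Real.pi / w i)) := by
  have hdet : Uᵀ.det ^ 2 = 1 := by
    have := congrArg Matrix.det hU
    rw [Matrix.det_mul, Matrix.det_one] at this
    rw [Matrix.det_transpose] at this ⊢
    rw [sq]; exact this
  have hne : Uᵀ.det ≠ 0 := by
    intro h; rw [h] at hdet; norm_num at hdet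
  have habs : |Uᵀ.det⁻¹| = 1 := by
    rw [abs_inv, (pow_eq_one_iff_of_nonneg (abs_nonneg _) two_ne_zero).1 ((sq_abs _).trans hdet),
      inv_one]
  have hmap := Real.map_matrix_volume_pi_eq_smul_volume_pi hne
  rw [habs, ENNReal.ofReal_one, one_smul] at hmap
  have hmeas : Measurable (Matrix.toLin' Uᵀ) :=
    (LinearMap.continuous_on_pi _).measurable
  have hquad : ∀ x : Fin p → ℝ, x ⬝ᵥ (U * Matrix.diagonal w * Uᵀ) *ᵥ x =
      ∑ i, w i * (Matrix.toLin' Uᵀ x i) ^ 2 := by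
    intro x
    rw [Matrix.mul_assoc, ← Matrix.mulVec_mulVec, Matrix.dotProduct_mulVec,
      ← Matrix.mulVec_transpose, ← Matrix.mulVec_mulVec, Matrix.toLin'_apply, dotProduct]
    refine Finset.sum_congr rfl fun i _ => ?_
    rw [Matrix.mulVec_diagonal]; ring
  have hg : ∀ z : Fin p → ℝ, ENNReal.ofReal (Real.exp (-(1 / 2) * ∑ i, w i * z i ^ 2)) =
      ∏ i, ENNReal.ofReal (Real.exp (-(w i / 2) * z i ^ 2)) := by
    intro z
    rw [← ENNReal.ofReal_prod_of_nonneg fun i _ => (Real.exp_pos _).le, ← Real.exp_sum,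
      Finset.mul_sum]
    congr 2
    exact Finset.sum_congr rfl fun i _ => by ring
  simp_rw [hquad]
  rw [← lintegral_map (μ := volume)
    (f := fun z : Fin p → ℝ => ENNReal.ofReal (Real.exp (-(1 / 2) * ∑ i, w i * z i ^ 2)))
    (by fun_prop) hmeas, hmap]
  simp_rw [hg]
  rw [volume_pi, lintegral_fin_prod _ (fun i x => ENNReal.ofReal (Real.exp (-(w i / 2) * x ^ 2)))
    (fun i => by fun_prop)]
  simp_rw [lintegral_exp_neg_mul_sq (hw _)]
  rw [ENNReal.ofReal_prod_of_nonneg fun i _ => Real.sqrt_nonneg _]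

/-! ### Spectrum of the adjacency matrix and the moment of order 3/2 -/

-- Gershgorin's circles bound each eigenvalue by the maximal degree. The sum of their squares is the
-- trace of the squared adjacency matrix, that is, the sum of the degrees.
open Classical in
theorem exists_spectral_adjMatrix {p d : ℕ} (G : SimpleGraph (Fin p))
    (hG : ∀ i, (G.neighborSet i).ncard ≤ d) :
    ∃ (U : Matrix (Fin p) (Fin p) ℝ) (l : Fin p → ℝ), U * Uᵀ = 1 ∧
      G.adjMatrix ℝ = U * Matrix.diagonal l * Uᵀ ∧ (∀ i, |l i| ≤ d) ∧
      ∑ i, l i ^ 2 ≤ p * d := by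
  have hE : (G.adjMatrix ℝ).IsHermitian := by
    rw [Matrix.IsHermitian, Matrix.conjTranspose_eq_transpose_of_trivial]
    exact G.isSymm_adjMatrix
  have hdeg : ∀ i, G.degree i ≤ d := fun i => by
    have := hG i
    rwa [Set.ncard_eq_toFinset_card'] at this
  have hU := Unitary.coe_mul_star_self hE.eigenvectorUnitary
  have hU' := Unitary.coe_star_mul_self hE.eigenvectorUnitary
  have hsp := hE.spectral_theorem
  rw [Unitary.conjStarAlgAut_apply] at hsp
  simp only [Matrix.star_eq_conjTranspose, Matrix.conjTranspose_eq_transpose_of_trivial]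
    at hU hU' hsp
  set U : Matrix (Fin p) (Fin p) ℝ := (hE.eigenvectorUnitary : Matrix (Fin p) (Fin p) ℝ)
  have hsp' : G.adjMatrix ℝ = U * Matrix.diagonal hE.eigenvalues * Uᵀ := hsp
  refine ⟨U, hE.eigenvalues, hU, hsp', fun i => ?_, ?_⟩
  · have hev : Module.End.HasEigenvalue (Matrix.toLin' (G.adjMatrix ℝ)) (hE.eigenvalues i) := by
      refine Module.End.hasEigenvalue_of_hasEigenvector
        (x := (hE.eigenvectorBasis i : Fin p → ℝ)) ⟨?_, ?_⟩
      · rw [Module.End.mem_eigenspace_iff, Matrix.toLin'_apply]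
        exact hE.mulVec_eigenvectorBasis i
      · intro h
        exact hE.eigenvectorBasis.orthonormal.ne_zero i (by ext j; exact congrFun h j)
    obtain ⟨k, hk⟩ := eigenvalue_mem_ball hev
    rw [Metric.mem_closedBall, Real.dist_eq] at hk
    have h1 : ∑ j ∈ Finset.univ.erase k, ‖G.adjMatrix ℝ k j‖ ≤ d := by
      calc _ ≤ ∑ j, ‖G.adjMatrix ℝ k j‖ :=
            Finset.sum_le_sum_of_subset_of_nonneg (Finset.erase_subset _ _)
              fun _ _ _ => norm_nonneg _
        _ = ∑ j, G.adjMatrix ℝ k j := Finset.sum_congr rfl fun j _ => by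
            rw [SimpleGraph.adjMatrix_apply]; split_ifs <;> simp
        _ = G.degree k := by
            simp [SimpleGraph.adjMatrix_apply, Finset.sum_boole, SimpleGraph.degree,
              SimpleGraph.neighborFinset_eq_filter]
        _ ≤ d := by exact_mod_cast hdeg k
    simpa using hk.trans h1
  · have h1 : (G.adjMatrix ℝ * G.adjMatrix ℝ).trace = ∑ i, hE.eigenvalues i ^ 2 := by
      have : G.adjMatrix ℝ * G.adjMatrix ℝ =
          U * (Matrix.diagonal hE.eigenvalues * Matrix.diagonal hE.eigenvalues * Uᵀ) := by
        calc _ = U * Matrix.diagonal hE.eigenvalues * (Uᵀ * U) *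
              (Matrix.diagonal hE.eigenvalues * Uᵀ) := by
                conv_lhs => rw [hsp']
                simp only [Matrix.mul_assoc]
          _ = _ := by rw [hU', Matrix.mul_one]; simp only [Matrix.mul_assoc]
      rw [this, Matrix.trace_mul_comm, Matrix.mul_assoc, hU', Matrix.mul_one,
        Matrix.diagonal_mul_diagonal, Matrix.trace_diagonal]
      exact Finset.sum_congr rfl fun i _ => by ring
    rw [← h1, Matrix.trace]
    calc _ = ∑ i, (G.degree i : ℝ) := Finset.sum_congr rfl fun i _ => by
          rw [Matrix.diag_apply, SimpleGraph.adjMatrix_mul_self_apply_self]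
      _ ≤ ∑ _i : Fin p, (d : ℝ) := Finset.sum_le_sum fun i _ => by exact_mod_cast hdeg i
      _ = p * d := by simp

theorem one_add_smul_conj {p : ℕ} {U E : Matrix (Fin p) (Fin p) ℝ} {l : Fin p → ℝ}
    (hU : U * Uᵀ = 1) (hE : E = U * Matrix.diagonal l * Uᵀ) (t : ℝ) :
    1 + t • E = U * Matrix.diagonal (fun i => 1 + t * l i) * Uᵀ := by
  have : Matrix.diagonal (fun i => 1 + t * l i) = 1 + t • Matrix.diagonal l := by
    ext i j
    by_cases h : i = j
    · subst h; simp
    · simp [h]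
  rw [this, Matrix.mul_add, Matrix.add_mul, Matrix.mul_one, hU, Matrix.mul_smul, Matrix.smul_mul,
    ← hE]

/-- The left side is `1 + u² (3/4 + u) / (1 + 3u/2)²`, so it suffices to bound the last fraction by
`1 / (1 - b)²` and use `1 + t ≤ exp t`. -/
theorem one_add_cube_div_le_exp {u b : ℝ} (hb : b < 1 / 2) (hu : |u| ≤ b) :
    (1 + u) ^ 3 / (1 + 3 / 2 * u) ^ 2 ≤ Real.exp (u ^ 2 / (1 - b) ^ 2) := by
  obtain ⟨h1, h2⟩ := abs_le.1 hu
  have hp : 0 < 1 + 3 / 2 * u := by linarith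
  have hb1 : 0 < 1 - b := by linarith
  have hkey : (3 / 4 + u) * (1 - |u|) ^ 2 ≤ (1 + 3 / 2 * u) ^ 2 := by
    rcases abs_cases u with ⟨h, h'⟩ | ⟨h, h'⟩ <;> rw [h]
    · have : (1 - u) ^ 2 ≤ 1 := by nlinarith
      nlinarith [mul_le_mul_of_nonneg_left this (by linarith : 0 ≤ 3 / 4 + u)]
    -- For negative `u` the difference of the two sides is exactly `(1/2 + u) (1/2 - u²)`, which is
    -- why `1/2` is the limit for `b`.
    · nlinarith [mul_nonneg (by linarith : 0 ≤ 1 / 2 + u) (by nlinarith : 0 ≤ 1 / 2 - u ^ 2)]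
  have hkey2 : (3 / 4 + u) * (1 - b) ^ 2 ≤ (1 + 3 / 2 * u) ^ 2 := by
    refine le_trans ?_ hkey
    have : (1 - b) ^ 2 ≤ (1 - |u|) ^ 2 := by gcongr
    exact mul_le_mul_of_nonneg_left this (by linarith)
  refine le_trans ?_ (Real.add_one_le_exp _)
  have : (1 + u) ^ 3 / (1 + 3 / 2 * u) ^ 2 =
      u ^ 2 * ((3 / 4 + u) / (1 + 3 / 2 * u) ^ 2) + 1 := by
    rw [div_eq_iff (by positivity), add_mul, mul_assoc, div_mul_cancel₀ _ (by positivity)]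
    ring
  rw [this]
  have h3 : (3 / 4 + u) / (1 + 3 / 2 * u) ^ 2 ≤ 1 / (1 - b) ^ 2 := by
    rw [div_le_div_iff₀ (by positivity) (by positivity)]; linarith
  have := mul_le_mul_of_nonneg_left h3 (sq_nonneg u)
  rw [mul_one_div] at this
  linarith

theorem prod_sqrt_div {p : ℕ} {c : ℝ} (hc : 0 ≤ c) {w : Fin p → ℝ} (hw : ∀ i, 0 < w i) :
    ∏ i, Real.sqrt (c / w i) = Real.sqrt (c ^ p * (∏ i, w i)⁻¹) := by
  rw [← Real.sqrt_prod _ fun i _ => div_nonneg hc (hw i).le, Finset.prod_div_distrib,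
    Finset.prod_const, Finset.card_univ, Fintype.card_fin, div_eq_mul_inv]

theorem gaussianDensity_conj {p : ℕ} {U : Matrix (Fin p) (Fin p) ℝ} (hU : U * Uᵀ = 1)
    {w : Fin p → ℝ} (hw : ∀ i, 0 < w i) (x : Fin p → ℝ) :
    gaussianDensity (U * Matrix.diagonal w * Uᵀ) x =
      (∏ i, Real.sqrt (2 * Real.pi / w i))⁻¹ *
        Real.exp (-(1 / 2) * (x ⬝ᵥ (U * Matrix.diagonal w * Uᵀ) *ᵥ x)) := by
  have hdet : (U * Matrix.diagonal w * Uᵀ).det = ∏ i, w i := by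
    have := congrArg Matrix.det hU
    rw [Matrix.det_mul, Matrix.det_one] at this
    rw [Matrix.det_mul, Matrix.det_mul, Matrix.det_diagonal, mul_right_comm, this, one_mul]
  rw [gaussianDensity, Matrix.det_nonsing_inv, Ring.inverse_eq_inv', hdet,
    prod_sqrt_div (by positivity) hw]

theorem prod_sqrt_pos {p : ℕ} {w : Fin p → ℝ} (hw : ∀ i, 0 < w i) :
    0 < ∏ i, Real.sqrt (2 * Real.pi / w i) :=
  Finset.prod_pos fun i _ => Real.sqrt_pos.2 (div_pos (by positivity) (hw i))

theorem gaussianDensity_conj_pos {p : ℕ} {U : Matrix (Fin p) (Fin p) ℝ} (hU : U * Uᵀ = 1)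
    {w : Fin p → ℝ} (hw : ∀ i, 0 < w i) (x : Fin p → ℝ) :
    0 < gaussianDensity (U * Matrix.diagonal w * Uᵀ) x := by
  rw [gaussianDensity_conj hU hw]
  exact mul_pos (inv_pos.2 (prod_sqrt_pos hw)) (Real.exp_pos _)

theorem lintegral_gaussianDensity_conj {p : ℕ} {U : Matrix (Fin p) (Fin p) ℝ} (hU : U * Uᵀ = 1)
    {w : Fin p → ℝ} (hw : ∀ i, 0 < w i) :
    ∫⁻ x, ENNReal.ofReal (gaussianDensity (U * Matrix.diagonal w * Uᵀ) x) = 1 := by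
  have hpos := prod_sqrt_pos hw
  simp_rw [gaussianDensity_conj hU hw, ENNReal.ofReal_mul (inv_pos.2 hpos).le]
  rw [lintegral_const_mul' _ _ ENNReal.ofReal_ne_top, lintegral_exp_neg_quadForm U hU w hw,
    ← ENNReal.ofReal_mul (inv_pos.2 hpos).le, inv_mul_cancel₀ hpos.ne', ENNReal.ofReal_one]

theorem measurable_gaussianDensity {p : ℕ} (J : Matrix (Fin p) (Fin p) ℝ) :
    Measurable (gaussianDensity J) := by
  unfold gaussianDensity
  refine Continuous.measurable ?_
  have : Continuous fun x : Fin p → ℝ => x ⬝ᵥ J *ᵥ x :=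
    continuous_id.dotProduct (continuous_const.matrix_mulVec continuous_id)
  fun_prop

theorem gaussianDensity_one_pos {p : ℕ} (x : Fin p → ℝ) : 0 < gaussianDensity 1 x := by
  have := gaussianDensity_conj_pos (U := 1) (w := fun _ : Fin p => (1 : ℝ)) (by simp)
    (fun _ => one_pos) x
  simpa using this

theorem lintegral_gaussianDensity_one {p : ℕ} :
    ∫⁻ x : Fin p → ℝ, ENNReal.ofReal (gaussianDensity 1 x) = 1 := by
  have := lintegral_gaussianDensity_conj (U := 1) (w := fun _ : Fin p => (1 : ℝ)) (by simp)
    (fun _ => one_pos)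
  simpa using this

theorem one_add_mul_pos {t l D : ℝ} (ht : 0 ≤ t) (hl : |l| ≤ D) (h : D * t < 1) :
    0 < 1 + t * l := by
  have h1 : -D ≤ l := (abs_le.1 hl).1
  nlinarith [mul_le_mul_of_nonneg_left h1 ht]

theorem precision_spectral {p d : ℕ} (θ : ℝ)
    (G : SimpleGraph (Fin p)) (hG : ∀ i, (G.neighborSet i).ncard ≤ d) :
    ∃ (U : Matrix (Fin p) (Fin p) ℝ) (l : Fin p → ℝ), U * Uᵀ = 1 ∧
      precision θ G = U * Matrix.diagonal (fun i => 1 + θ * l i) * Uᵀ ∧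
      (∀ i, |l i| ≤ d) ∧ ∑ i, l i ^ 2 ≤ p * d := by
  obtain ⟨U, l, hU, hE, hl, hs⟩ := exists_spectral_adjMatrix G hG
  exact ⟨U, l, hU, one_add_smul_conj hU hE θ, hl, hs⟩

theorem gaussianDensity_precision_pos {p d : ℕ} {θ : ℝ} (hθ : 0 < θ) (hdθ : (d : ℝ) * θ < 1 / 2)
    (G : SimpleGraph (Fin p)) (hG : ∀ i, (G.neighborSet i).ncard ≤ d) (x : Fin p → ℝ) :
    0 < gaussianDensity (precision θ G) x := by
  obtain ⟨U, l, hU, hJ, hl, -⟩ := precision_spectral θ G hG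
  rw [hJ]
  exact gaussianDensity_conj_pos hU (fun i => one_add_mul_pos hθ.le (hl i) (by linarith)) x

theorem lintegral_gaussianDensity_precision {p d : ℕ} {θ : ℝ} (hθ : 0 < θ)
    (hdθ : (d : ℝ) * θ < 1 / 2)
    (G : SimpleGraph (Fin p)) (hG : ∀ i, (G.neighborSet i).ncard ≤ d) :
    ∫⁻ x, ENNReal.ofReal (gaussianDensity (precision θ G) x) = 1 := by
  obtain ⟨U, l, hU, hJ, hl, -⟩ := precision_spectral θ G hG
  rw [hJ]
  exact lintegral_gaussianDensity_conj hU
    (fun i => one_add_mul_pos hθ.le (hl i) (by linarith))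

/-- This is the contribution of one eigendirection, with `u = θ * l i`, to the moment of order 3/2.
Its fourth power removes the nested roots and is `(1 + u)³ / (1 + 3u/2)²`. -/
theorem moment_factor_le {u b : ℝ} (hb : b < 1 / 2) (hu : |u| ≤ b) :
    (Real.sqrt (2 * Real.pi / (1 + u)))⁻¹ * Real.sqrt (Real.sqrt (1 + u)) *
      Real.sqrt (2 * Real.pi / (1 + 3 / 2 * u)) ≤ Real.exp (u ^ 2 / (4 * (1 - b) ^ 2)) := by
  obtain ⟨h1, h2⟩ := abs_le.1 hu
  have hw : 0 < 1 + u := by linarith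
  have hv : 0 < 1 + 3 / 2 * u := by linarith
  refine le_of_pow_le_pow_left₀ (n := 4) (by norm_num) (Real.exp_pos _).le ?_
  have e1 : ∀ a : ℝ, 0 ≤ a → Real.sqrt a ^ 4 = a ^ 2 := fun a ha => by
    rw [show (4 : ℕ) = 2 * 2 from rfl, pow_mul, Real.sq_sqrt ha]
  rw [← Real.exp_nat_mul, mul_pow, mul_pow, inv_pow, e1 _ (by positivity), e1 _ (by positivity),
    e1 _ (by positivity), Real.sq_sqrt hw.le]
  have := one_add_cube_div_le_exp hb hu
  have hb1 : 1 - b ≠ 0 := by linarith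
  have hπ := Real.pi_ne_zero
  refine le_trans (le_of_eq ?_) (this.trans (le_of_eq ?_))
  · clear this
    generalize 1 + 3 / 2 * u = v at *
    field_simp
  · congr 1; push_cast; field_simp

/-- The integrand `f ^ (3/2) * q ^ (-1/2)` is an unnormalised Gaussian with matrix `3/2 J - 1/2 I =
I + 3/2 θ E`. It has the eigenvectors of `J`, so the integral factors over the eigenvalues, whose
squares sum to at most `p d`. -/
theorem lintegral_density_mul_sqrt_le {p d : ℕ} {θ : ℝ} (hθ : 0 < θ) (hdθ : (d : ℝ) * θ < 1 / 2)
    (G : SimpleGraph (Fin p)) (hG : ∀ i, (G.neighborSet i).ncard ≤ d) :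
    ∫⁻ x, ENNReal.ofReal (gaussianDensity (precision θ G) x *
        Real.sqrt (gaussianDensity (precision θ G) x / gaussianDensity 1 x)) ≤
      ENNReal.ofReal (Real.exp (p * d * (θ / (1 - d * θ)) ^ 2 / 4)) := by
  obtain ⟨U, l, hU, hJ, hl, hs⟩ := precision_spectral θ G hG
  have hw : ∀ i, 0 < 1 + θ * l i := fun i => one_add_mul_pos hθ.le (hl i) (by linarith)
  have hv : ∀ i, 0 < 1 + 3 / 2 * (θ * l i) := fun i => by
    rw [← mul_assoc]; exact one_add_mul_pos (by linarith) (hl i) (by linarith)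
  have hu : ∀ i, |θ * l i| ≤ d * θ := fun i => by
    rw [abs_mul, abs_of_pos hθ, mul_comm]; exact mul_le_mul_of_nonneg_right (hl i) hθ.le
  set c := (∏ i, Real.sqrt (2 * Real.pi / (1 + θ * l i)))⁻¹ with hc
  set c' := Real.sqrt (∏ i, Real.sqrt (1 + θ * l i)) with hc'
  have hcpos : 0 < c := inv_pos.2 (prod_sqrt_pos hw)
  have hint : ∀ x, gaussianDensity (precision θ G) x *
      Real.sqrt (gaussianDensity (precision θ G) x / gaussianDensity 1 x) = c * c' *
        Real.exp (-(1 / 2) *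
          (x ⬝ᵥ (U * Matrix.diagonal (fun i => 1 + 3 / 2 * (θ * l i)) * Uᵀ) *ᵥ x)) := by
    intro x
    have hq : gaussianDensity 1 x = (∏ _i : Fin p, Real.sqrt (2 * Real.pi))⁻¹ *
        Real.exp (-(1 / 2) * (x ⬝ᵥ x)) := by
      have := gaussianDensity_conj (U := 1) (w := fun _ : Fin p => (1 : ℝ)) (by simp)
        (fun _ => one_pos) x
      simpa using this
    have hJx : x ⬝ᵥ (U * Matrix.diagonal (fun i => 1 + 3 / 2 * (θ * l i)) * Uᵀ) *ᵥ x =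
        3 / 2 * (x ⬝ᵥ precision θ G *ᵥ x) - 1 / 2 * (x ⬝ᵥ x) := by
      have h := one_add_smul_conj hU (E := U * Matrix.diagonal l * Uᵀ) rfl
      have h2 := h (3 / 2 * θ)
      simp_rw [mul_assoc (3 / 2 : ℝ)] at h2
      rw [hJ, ← h2, ← h θ]
      simp only [Matrix.add_mulVec, Matrix.one_mulVec, Matrix.smul_mulVec, dotProduct_add,
        dotProduct_smul, smul_eq_mul]
      ring
    have hf := gaussianDensity_conj hU hw x
    rw [← hJ] at hf
    have hratio : gaussianDensity (precision θ G) x / gaussianDensity 1 x =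
        (∏ i, Real.sqrt (1 + θ * l i)) *
          Real.exp (2 * (-(1 / 4) * (x ⬝ᵥ precision θ G *ᵥ x - x ⬝ᵥ x))) := by
      have h1 : ∏ i, Real.sqrt (1 + θ * l i) =
          c * ∏ _i : Fin p, Real.sqrt (2 * Real.pi) := by
        rw [hc, ← Finset.prod_inv_distrib, ← Finset.prod_mul_distrib]
        refine Finset.prod_congr rfl fun i _ => ?_
        rw [Real.sqrt_div (by positivity), inv_div, div_mul_cancel₀]
        exact (Real.sqrt_pos.2 (by positivity)).ne'
      have hπ : (∏ _i : Fin p, Real.sqrt (2 * Real.pi)) ≠ 0 :=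
        (Finset.prod_pos fun _ _ => Real.sqrt_pos.2 (by positivity)).ne'
      rw [hf, ← hc, hq, h1, show 2 * (-(1 / 4) * (x ⬝ᵥ precision θ G *ᵥ x - x ⬝ᵥ x)) =
        -(1 / 2) * (x ⬝ᵥ precision θ G *ᵥ x) - -(1 / 2) * (x ⬝ᵥ x) by ring, Real.exp_sub]
      have := (Real.exp_pos (-(1 / 2) * (x ⬝ᵥ x))).ne'
      field_simp
    rw [hratio, Real.sqrt_mul (Finset.prod_nonneg fun _ _ => Real.sqrt_nonneg _), ← hc', two_mul,
      Real.exp_add, Real.sqrt_mul_self (Real.exp_pos _).le, hf, hJx, mul_mul_mul_comm,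
      ← Real.exp_add]
    congr 2
    ring
  have hcc : 0 ≤ c * c' := mul_nonneg hcpos.le (Real.sqrt_nonneg _)
  simp_rw [hint, ENNReal.ofReal_mul hcc]
  rw [lintegral_const_mul' _ _ ENNReal.ofReal_ne_top, lintegral_exp_neg_quadForm U hU _ hv,
    ← ENNReal.ofReal_mul hcc]
  refine ENNReal.ofReal_le_ofReal ?_
  rw [hc, hc', Real.sqrt_prod _ fun _ _ => Real.sqrt_nonneg _, ← Finset.prod_inv_distrib,
    ← Finset.prod_mul_distrib, ← Finset.prod_mul_distrib]
  refine (Finset.prod_le_prod (fun i _ => by positivity)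
    fun i _ => moment_factor_le hdθ (hu i)).trans ?_
  rw [← Real.exp_sum, Real.exp_le_exp]
  have h1 : ∑ i, (θ * l i) ^ 2 / (4 * (1 - d * θ) ^ 2) =
      (θ / (1 - d * θ)) ^ 2 / 4 * ∑ i, l i ^ 2 := by
    rw [Finset.mul_sum]
    refine Finset.sum_congr rfl fun i _ => ?_
    have : 1 - (d : ℝ) * θ ≠ 0 := by linarith
    field_simp
  rw [h1]
  calc _ ≤ (θ / (1 - d * θ)) ^ 2 / 4 * (p * d) := mul_le_mul_of_nonneg_left hs (by positivity)
    _ = _ := by ring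

/-! ### Change of measure and the error of a decoder -/

theorem pi_withDensity {n : ℕ} {α : Type*} [MeasurableSpace α] (μ : Measure α) [SigmaFinite μ]
    (f : α → ℝ≥0∞) (hf : Measurable f) [IsFiniteMeasure (μ.withDensity f)] :
    (Measure.pi fun _ : Fin n => μ.withDensity f) =
      (Measure.pi fun _ : Fin n => μ).withDensity fun x => ∏ i, f (x i) := by
  refine Measure.pi_eq fun s hs => ?_
  rw [withDensity_apply _ (MeasurableSet.univ_pi hs), ← lintegral_indicator
    (MeasurableSet.univ_pi hs)]
  have : ∀ x : Fin n → α, (Set.univ.pi s).indicator (fun x => ∏ i, f (x i)) x =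
      ∏ i, (s i).indicator f (x i) := by
    intro x
    by_cases hx : x ∈ Set.univ.pi s
    · rw [Set.indicator_of_mem hx]
      exact Finset.prod_congr rfl fun i _ => by
        rw [Set.indicator_of_mem (hx i (Set.mem_univ i))]
    · rw [Set.indicator_of_notMem hx]
      simp only [Set.mem_pi, Set.mem_univ, true_implies, not_forall] at hx
      obtain ⟨i, hi⟩ := hx
      exact (Finset.prod_eq_zero (Finset.mem_univ i) (Set.indicator_of_notMem hi _)).symm
  simp_rw [this]
  rw [lintegral_fin_prod μ (fun i => (s i).indicator f) fun i => hf.indicator (hs i)]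
  refine Finset.prod_congr rfl fun i _ => ?_
  rw [lintegral_indicator (hs i), withDensity_apply _ (hs i)]

/-- Where `F` exceeds `K * Q`, the factor `√(F / (K Q))` is at least 1. This is Markov's inequality
for the likelihood ratio, in pointwise form. -/
theorem le_mul_add_mul_sqrt_div {F Q K : ℝ} (hF : 0 < F) (hQ : 0 < Q) (hK : 0 < K) :
    F ≤ K * Q + (Real.sqrt K)⁻¹ * (F * Real.sqrt (F / Q)) := by
  have hs := Real.sqrt_pos.2 hK
  rcases le_or_gt F (K * Q) with h | h
  · have : 0 ≤ (Real.sqrt K)⁻¹ * (F * Real.sqrt (F / Q)) := by positivity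
    linarith
  · have h1 : Real.sqrt K ≤ Real.sqrt (F / Q) :=
      Real.sqrt_le_sqrt ((le_div_iff₀ hQ).2 h.le)
    have h2 : F ≤ (Real.sqrt K)⁻¹ * (F * Real.sqrt (F / Q)) := by
      rw [inv_mul_eq_div, le_div_iff₀ hs]
      exact mul_le_mul_of_nonneg_left h1 hF.le
    have : 0 < K * Q := by positivity
    linarith

theorem lintegral_fin_prod_ofReal {n : ℕ} {α : Type*} [MeasurableSpace α] (μ : Measure α)
    [SigmaFinite μ] (g : α → ℝ) (hg : Measurable g) (h0 : ∀ x, 0 ≤ g x) :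
    ∫⁻ x, ENNReal.ofReal (∏ i, g (x i)) ∂(Measure.pi fun _ : Fin n => μ) =
      (∫⁻ x, ENNReal.ofReal (g x) ∂μ) ^ n := by
  simp_rw [ENNReal.ofReal_prod_of_nonneg fun i (_ : i ∈ Finset.univ) => h0 _]
  rw [lintegral_fin_prod μ (fun _ x => ENNReal.ofReal (g x)) fun _ => hg.ennreal_ofReal]
  simp

/-- Change of measure for a family of tests: if every density `f i` has moment
`∫ f i * √(f i / q) ≤ m` against the reference density `q`, then disjoint decision regions
cannot capture much total mass. -/
theorem sum_pi_withDensity_le {ι α : Type*} [MeasurableSpace α] (μ : Measure α) [SigmaFinite μ]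
    (n : ℕ) (S : Finset ι) (f : ι → α → ℝ) (q : α → ℝ) (m K : ℝ) (hK : 0 < K) (hm : 0 ≤ m)
    (hf : ∀ i ∈ S, Measurable (f i)) (hq : Measurable q)
    (hf0 : ∀ i ∈ S, ∀ x, 0 < f i x) (hq0 : ∀ x, 0 < q x)
    (hf1 : ∀ i ∈ S, ∫⁻ x, ENNReal.ofReal (f i x) ∂μ = 1)
    (hq1 : ∫⁻ x, ENNReal.ofReal (q x) ∂μ = 1)
    (hfm : ∀ i ∈ S, ∫⁻ x, ENNReal.ofReal (f i x * Real.sqrt (f i x / q x)) ∂μ ≤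
      ENNReal.ofReal m)
    (D : ι → Set (Fin n → α)) (hD : ∀ i, MeasurableSet (D i))
    (hdisj : (S : Set ι).PairwiseDisjoint D) :
    ∑ i ∈ S, (Measure.pi fun _ : Fin n => μ.withDensity fun x => ENNReal.ofReal (f i x)) (D i) ≤
      ENNReal.ofReal (K + S.card * ((Real.sqrt K)⁻¹ * m ^ n)) := by
  set P := Measure.pi fun _ : Fin n => μ
  have hQm : Measurable fun x : Fin n → α => ENNReal.ofReal (∏ j, q (x j)) :=
    (Finset.measurable_prod _ fun j _ => hq.comp (measurable_pi_apply j)).ennreal_ofReal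
  have hs : 0 ≤ (Real.sqrt K)⁻¹ := inv_nonneg.2 (Real.sqrt_nonneg K)
  have hstep : ∀ i ∈ S,
      (Measure.pi fun _ : Fin n => μ.withDensity fun x => ENNReal.ofReal (f i x)) (D i) ≤
        ENNReal.ofReal K * (∫⁻ x in D i, ENNReal.ofReal (∏ j, q (x j)) ∂P) +
          ENNReal.ofReal ((Real.sqrt K)⁻¹ * m ^ n) := by
    intro i hi
    have : IsFiniteMeasure (μ.withDensity fun x => ENNReal.ofReal (f i x)) :=
      isFiniteMeasure_withDensity (by rw [hf1 i hi]; exact ENNReal.one_ne_top)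
    rw [pi_withDensity μ _ (hf i hi).ennreal_ofReal, withDensity_apply _ (hD i)]
    set g : α → ℝ := fun x => f i x * Real.sqrt (f i x / q x) with hg
    have hgm : Measurable g := (hf i hi).mul ((hf i hi).div hq).sqrt
    have hg0 : ∀ x, 0 ≤ g x := fun x => mul_nonneg (hf0 i hi x).le (Real.sqrt_nonneg _)
    have hpt : ∀ x : Fin n → α, ∏ j, ENNReal.ofReal (f i (x j)) ≤
        ENNReal.ofReal K * ENNReal.ofReal (∏ j, q (x j)) +
          ENNReal.ofReal (Real.sqrt K)⁻¹ * ENNReal.ofReal (∏ j, g (x j)) := by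
      intro x
      have hF : 0 < ∏ j, f i (x j) := Finset.prod_pos fun j _ => hf0 i hi _
      have hQ : 0 < ∏ j, q (x j) := Finset.prod_pos fun j _ => hq0 _
      rw [← ENNReal.ofReal_prod_of_nonneg fun j _ => (hf0 i hi _).le,
        ← ENNReal.ofReal_mul hK.le, ← ENNReal.ofReal_mul hs, ← ENNReal.ofReal_add (by positivity)
          (mul_nonneg hs (Finset.prod_nonneg fun j _ => hg0 _))]
      refine ENNReal.ofReal_le_ofReal ?_
      have := le_mul_add_mul_sqrt_div hF hQ hK
      rwa [← Finset.prod_div_distrib,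
        Real.sqrt_prod _ fun j _ => div_nonneg (hf0 i hi _).le (hq0 _).le,
        ← Finset.prod_mul_distrib] at this
    calc _ ≤ ∫⁻ x in D i, (ENNReal.ofReal K * ENNReal.ofReal (∏ j, q (x j)) +
          ENNReal.ofReal (Real.sqrt K)⁻¹ * ENNReal.ofReal (∏ j, g (x j))) ∂P :=
          lintegral_mono hpt
      _ = ENNReal.ofReal K * (∫⁻ x in D i, ENNReal.ofReal (∏ j, q (x j)) ∂P) +
          ENNReal.ofReal (Real.sqrt K)⁻¹ *
            ∫⁻ x in D i, ENNReal.ofReal (∏ j, g (x j)) ∂P := by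
          rw [lintegral_add_left (hQm.const_mul _), lintegral_const_mul' _ _ ENNReal.ofReal_ne_top,
            lintegral_const_mul' _ _ ENNReal.ofReal_ne_top]
      _ ≤ _ := by
          rw [ENNReal.ofReal_mul hs, ENNReal.ofReal_pow hm]
          gcongr
          refine (setLIntegral_le_lintegral _ _).trans ?_
          rw [lintegral_fin_prod_ofReal μ g hgm hg0]
          exact pow_le_pow_left' (hfm i hi) n
  refine (Finset.sum_le_sum hstep).trans ?_
  -- Disjointness enters only here: the regions together have mass at most 1 under the common
  -- reference law.
  rw [Finset.sum_add_distrib, ← Finset.mul_sum, Finset.sum_const, nsmul_eq_mul,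
    ← lintegral_biUnion_finset hdisj fun i _ => hD i,
    ENNReal.ofReal_add hK.le (by positivity), ENNReal.ofReal_mul (Nat.cast_nonneg _),
    ENNReal.ofReal_natCast]
  gcongr
  calc _ ≤ ENNReal.ofReal K * 1 := by
        gcongr
        refine (setLIntegral_le_lintegral _ _).trans ?_
        rw [lintegral_fin_prod_ofReal μ q hq fun x => (hq0 x).le, hq1, one_pow]
    _ = _ := mul_one _

theorem isProbabilityMeasure_sampleLaw {p d : ℕ} {θ : ℝ} (hθ : 0 < θ)
    (hdθ : (d : ℝ) * θ < 1 / 2) (G : SimpleGraph (Fin p))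
    (hG : ∀ i, (G.neighborSet i).ncard ≤ d) : IsProbabilityMeasure (sampleLaw θ G) := by
  refine ⟨?_⟩
  rw [sampleLaw, withDensity_apply _ MeasurableSet.univ, Measure.restrict_univ]
  exact lintegral_gaussianDensity_precision hθ hdθ G hG

/-- If the family is large compared with the moments of the samples, then every decoder errs
with average probability at least one half. -/
theorem half_le_average_error {d p n : ℕ} {θ β : ℝ} (hθ : 0 < θ) (hdθ : (d : ℝ) * θ < 1 / 2)
    (y : Fin p → Plane) (φ : (Fin n → Fin p → ℝ) → SimpleGraph (Fin p))
    (hφ : ∀ G, MeasurableSet {x | φ x = G})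
    (hcard : 64 * (Real.exp (p * d * (θ / (1 - d * θ)) ^ 2 / 4)) ^ (2 * n) ≤
      ((admissible d β y).card : ℝ)) :
    2⁻¹ ≤ ((admissible d β y).card : ℝ≥0∞)⁻¹ *
      ∑ G ∈ admissible d β y,
        (Measure.pi fun _ : Fin n => sampleLaw θ G) {x | φ x ≠ G} := by
  set S := admissible d β y
  set m := Real.exp (p * d * (θ / (1 - d * θ)) ^ 2 / 4)
  have hm : 0 < m := Real.exp_pos _
  have hdeg : ∀ G ∈ S, ∀ i, (G.neighborSet i).ncard ≤ d := by
    classical exact fun G hG => (Finset.mem_filter.1 hG).2.degree_le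
  set N : ℝ := (S.card : ℝ) with hN
  have hNpos : 0 < N := lt_of_lt_of_le (by positivity) hcard
  have hsucc : ∑ G ∈ S, (Measure.pi fun _ : Fin n => sampleLaw θ G) {x | φ x = G} ≤
      ENNReal.ofReal (N / 2) := by
    -- With `K = N / 4` the bound reads `N / 4 + 2 m ^ n √N`, and the hypothesis `8 m ^ n ≤ √N`
    -- makes it at most `N / 2`.
    refine (sum_pi_withDensity_le volume n S (fun G => gaussianDensity (precision θ G))
      (gaussianDensity 1) m (N / 4) (by positivity) hm.le
      (fun G _ => measurable_gaussianDensity _) (measurable_gaussianDensity _)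
      (fun G hG => gaussianDensity_precision_pos hθ hdθ G (hdeg G hG)) gaussianDensity_one_pos
      (fun G hG => lintegral_gaussianDensity_precision hθ hdθ G (hdeg G hG))
      lintegral_gaussianDensity_one
      (fun G hG => lintegral_density_mul_sqrt_le hθ hdθ G (hdeg G hG)) _ hφ ?_).trans ?_
    · intro G _ G' _ h
      refine Set.disjoint_left.2 fun x hx hx' => h ?_
      exact Eq.trans (Eq.symm hx) hx'
    · refine ENNReal.ofReal_le_ofReal ?_
      rw [← hN]
      have h4 : Real.sqrt 4 = 2 := by
        rw [show (4 : ℝ) = 2 ^ 2 by norm_num]; exact Real.sqrt_sq (by norm_num)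
      have hs : 0 < Real.sqrt N := Real.sqrt_pos.2 hNpos
      have hss : Real.sqrt N * Real.sqrt N = N := Real.mul_self_sqrt hNpos.le
      have h8 : 8 * m ^ n ≤ Real.sqrt N := by
        refine Real.le_sqrt_of_sq_le ?_
        calc (8 * m ^ n) ^ 2 = 64 * m ^ (2 * n) := by ring
          _ ≤ N := hcard
      have : N * ((Real.sqrt (N / 4))⁻¹ * m ^ n) = 2 * m ^ n * Real.sqrt N := by
        rw [Real.sqrt_div hNpos.le, h4]
        field_simp
        rw [sq, hss]
      rw [this]
      nlinarith
  have htot : ∑ G ∈ S, (Measure.pi fun _ : Fin n => sampleLaw θ G) {x | φ x = G} +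
      ∑ G ∈ S, (Measure.pi fun _ : Fin n => sampleLaw θ G) {x | φ x ≠ G} = ENNReal.ofReal N := by
    rw [← Finset.sum_add_distrib, hN, ENNReal.ofReal_natCast, Finset.card_eq_sum_ones,
      Nat.cast_sum, Nat.cast_one]
    refine Finset.sum_congr rfl fun G hG => ?_
    have := isProbabilityMeasure_sampleLaw hθ hdθ G (hdeg G hG)
    exact prob_add_prob_compl (hφ G)
  have herr : ENNReal.ofReal (N / 2) ≤
      ∑ G ∈ S, (Measure.pi fun _ : Fin n => sampleLaw θ G) {x | φ x ≠ G} := by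
    refine (ENNReal.add_le_add_iff_left (a := ENNReal.ofReal (N / 2)) ENNReal.ofReal_ne_top).1 ?_
    calc _ = ENNReal.ofReal N := by
          rw [← ENNReal.ofReal_add (by positivity) (by positivity), add_halves]
      _ ≤ _ := by rw [← htot]; gcongr
  calc (2⁻¹ : ℝ≥0∞) = (S.card : ℝ≥0∞)⁻¹ * ENNReal.ofReal (N / 2) := by
        rw [← ENNReal.ofReal_natCast, ← ENNReal.ofReal_inv_of_pos hNpos,
          ← ENNReal.ofReal_mul (by positivity),
          show N⁻¹ * (N / 2) = 2⁻¹ by field_simp, ENNReal.ofReal_inv_of_pos two_pos]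
        simp
    _ ≤ _ := by gcongr

/-! ### Vertex law, comparison of exponents, conclusion -/

theorem volume_square_ne_zero_top {s : ℝ} (hs : 0 < s) :
    MeasurableSet (square s) ∧ volume (square s) ≠ 0 ∧ volume (square s) ≠ ⊤ := by
  have hsq : square s = WithLp.ofLp ⁻¹' (Set.univ.pi fun _ : Fin 2 => Set.Icc 0 s) := by
    ext y; simp only [square, Set.mem_ofPred_eq, Set.mem_preimage, Set.mem_univ_pi]
  have hm : MeasurableSet (Set.univ.pi fun _ : Fin 2 => Set.Icc 0 s) :=
    MeasurableSet.univ_pi fun _ => measurableSet_Icc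
  have hmp := PiLp.volume_preserving_ofLp (Fin 2)
  have hvol : volume (square s) = ENNReal.ofReal s ^ 2 := by
    rw [hsq, hmp.measure_preimage hm.nullMeasurableSet, volume_pi_pi]
    simp
  refine ⟨hsq ▸ hmp.measurable hm, ?_, ?_⟩
  · rw [hvol]; exact pow_ne_zero _ (by simpa using hs)
  · rw [hvol]; exact ENNReal.pow_ne_top ENNReal.ofReal_ne_top

theorem vertexLaw_square {η : ℝ} {p : ℕ} (hs : 0 < Real.sqrt (p / η)) :
    vertexLaw η p (Set.univ.pi fun _ => square (Real.sqrt (p / η))) = 1 := by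
  obtain ⟨hm, h0, ht⟩ := volume_square_ne_zero_top hs
  have := cond_isProbabilityMeasure_of_finite h0 ht
  rw [vertexLaw, Measure.pi_pi]
  refine Finset.prod_eq_one fun i _ => ?_
  rw [cond_apply hm, Set.inter_self, ENNReal.inv_mul_cancel h0 ht]

/-- In logarithms, the moments cost at most `p d log A / 4`. Since `d ≤ 3 ⌊d/2⌋` and `log 100 ≤ log
A / 10`, the right side is at least `(3/10) p d log A`. The surplus `p d log A / 20 ≥ log A / 10 ≥
log 100` pays for the factor 64; this fixes the constant `100 ^ 10`. -/
theorem moment_le_pow {A Δ : ℝ} {n p d : ℕ} (hA : 100 ^ 10 ≤ A) (hd : 1 < d) (hp : 0 < p)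
    (hn : n * (2 * Δ) ≤ Real.log A) :
    64 * (Real.exp (p * d * Δ / 4)) ^ (2 * n) ≤ (A / 100) ^ (p * (d / 2)) := by
  have hA0 : 0 < A := lt_of_lt_of_le (by norm_num) hA
  have hL : 0 < Real.log 100 := Real.log_pos (by norm_num)
  have hLA : 10 * Real.log 100 ≤ Real.log A := by
    have := Real.log_le_log (by norm_num) hA
    rwa [Real.log_pow] at this
  have h64 : (64 : ℝ) ≤ Real.exp (Real.log 100) := by
    rw [Real.exp_log (by norm_num)]; norm_num
  have hr : (d : ℝ) ≤ 3 * (d / 2 : ℕ) := by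
    exact_mod_cast (by omega : d ≤ 3 * (d / 2))
  have hpd : (2 : ℝ) ≤ p * d := by exact_mod_cast (by nlinarith : 2 ≤ p * d)
  rw [← Real.exp_log (by positivity : 0 < A / 100), ← Real.exp_nat_mul, ← Real.exp_nat_mul]
  refine (mul_le_mul_of_nonneg_right h64 (Real.exp_pos _).le).trans ?_
  rw [← Real.exp_add, Real.exp_le_exp, Real.log_div hA0.ne' (by norm_num)]
  push_cast
  have e1 : 2 * (n : ℝ) * (p * d * Δ / 4) ≤ p * d * (Real.log A / 4) := by
    have := mul_le_mul_of_nonneg_left hn (by positivity : (0 : ℝ) ≤ p * d / 4)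
    nlinarith
  have e2 : (p * d : ℝ) * (3 / 10 * Real.log A) ≤
      p * (d / 2 : ℕ) * (Real.log A - Real.log 100) := by
    have h1 : 9 / 10 * Real.log A ≤ Real.log A - Real.log 100 := by linarith
    calc (p * d : ℝ) * (3 / 10 * Real.log A) ≤
          (p * (3 * (d / 2 : ℕ))) * (3 / 10 * Real.log A) := by
          gcongr
          linarith
      _ = p * (d / 2 : ℕ) * (9 / 10 * Real.log A) := by ring
      _ ≤ _ := by gcongr
  have e3 : 2 * (Real.log A / 20) ≤ p * d * (Real.log A / 20) := by
    gcongr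
    linarith
  linarith

/-- The bound 1/2 holds for each fixed placement in the square, and such placements have probability
1, so it survives integration over the vertices. -/
theorem half_le_errorProb {d p n : ℕ} {θ η β : ℝ} (hd : 1 < d) (hθ : 0 < θ)
    (hdθ : (d : ℝ) * θ < 1 / 2) (hη : 0 < η) (hβ : 0 < β) (hC : 100 ^ 10 * d ≤ η * β ^ 2)
    (hp : 0 < p) (hs : β / 2 ≤ Real.sqrt (p / η))
    (hn : (n : ℝ) < Real.log (η * β ^ 2 / d) / (2 * (θ / (1 - d * θ)) ^ 2))
    (ψ : (Fin p → Plane) × (Fin n → Fin p → ℝ) → SimpleGraph (Fin p))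
    (hψ : ∀ G, MeasurableSet {z | ψ z = G}) :
    2⁻¹ ≤ errorProb d θ η β p n ψ := by
  have hs0 : 0 < Real.sqrt (p / η) := lt_of_lt_of_le (by positivity) hs
  have hd0 : (0 : ℝ) < d := by exact_mod_cast (by omega : 0 < d)
  have hA : 100 ^ 10 ≤ η * β ^ 2 / d := (le_div_iff₀ hd0).2 hC
  have hδ : 0 < θ / (1 - d * θ) := div_pos hθ (by linarith)
  have hmom := moment_le_pow (Δ := (θ / (1 - d * θ)) ^ 2) hA hd hp
    ((lt_div_iff₀ (by positivity)).1 hn).le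
  calc (2⁻¹ : ENNReal) = ∫⁻ _ in Set.univ.pi fun _ : Fin p => square (Real.sqrt (p / η)),
        2⁻¹ ∂(vertexLaw η p) := by
        rw [setLIntegral_const, vertexLaw_square hs0, mul_one]
    _ ≤ ∫⁻ y in Set.univ.pi fun _ : Fin p => square (Real.sqrt (p / η)),
          ((admissible d β y).card : ENNReal)⁻¹ * ∑ G ∈ admissible d β y,
          (Measure.pi fun _ : Fin n => sampleLaw θ G) {x | ψ (y, x) ≠ G} ∂(vertexLaw η p) := by
        refine setLIntegral_mono'
          (MeasurableSet.univ_pi fun _ => (volume_square_ne_zero_top hs0).1) fun y hy => ?_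
        exact half_le_average_error hθ hdθ y (fun x => ψ (y, x))
          (fun G => measurable_prodMk_left (hψ G))
          (hmom.trans (pow_le_card_admissible hd hη hβ hs y fun i => hy i (Set.mem_univ i)))
    _ ≤ _ := setLIntegral_le_lintegral _ _

end GeomGraph

end

theorem proposition1 :
    ∃ C : ℝ, 0 < C ∧
      ∀ (d : ℕ) (θ η β : ℝ), 1 < d → 0 < θ → (d : ℝ) * θ < 1 / 2 → 0 < η → 0 < β →
        C * d ≤ η * β ^ 2 →
        ∀ (n : ℕ → ℕ)
          (ψ : ∀ p : ℕ,
            (Fin p → GeomGraph.Plane) × (Fin (n p) → Fin p → ℝ) → SimpleGraph (Fin p)),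
          (∀ (p : ℕ) (G : SimpleGraph (Fin p)), MeasurableSet {z | ψ p z = G}) →
          Tendsto (fun p => GeomGraph.errorProb d θ η β p (n p) (ψ p)) atTop (𝓝 0) →
          ∀ᶠ p in atTop,
            Real.log (η * β ^ 2 / d) / (2 * (θ / (1 - d * θ)) ^ 2) ≤ (n p : ℝ) := by
  refine ⟨100 ^ 10, by norm_num, fun d θ η β hd hθ hdθ hη hβ hC n ψ hψ hlim => ?_⟩
  have hside : Tendsto (fun p : ℕ => Real.sqrt (p / η)) atTop atTop :=
    Real.tendsto_sqrt_atTop.comp (tendsto_natCast_atTop_atTop.atTop_div_const hη)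
  -- Large `p` serves to bring the error below 1/2 and to make the square at least one cell wide.
  filter_upwards [hlim.eventually_lt_const (by simp : (0 : ENNReal) < 2⁻¹),
    hside.eventually_ge_atTop (β / 2), eventually_gt_atTop 0] with p herr hs hp
  by_contra! hn
  exact absurd (GeomGraph.half_le_errorProb hd hθ hdθ hη hβ hC hp hs hn (ψ p) (hψ p)) (not_le.2 herr)
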